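/- Let $E$ be a locally compact separable metric space with its Borel $\sigma$-field, let $\mathcal P(E)$ be the space of Borel probability measures on $E$ with the topology of weak convergence, and let $C(E)$ be the set of bounded continuous functions $E\to\mathbb R$. Let $P(x,\cdot)$ be a Markov transition kernel on $E$ with the Feller property: $Pf(x)=\int_E f(y)\,P(x,dy)$ is continuous in $x$ for every $f\in C(E)$. Let $(X_n)_{n\ge 0}$ be an adapted $E$-valued process on a filtered measurable space $(\Omega,\mathcal F,(\mathcal F_n))$ and let $(\mathbb P_{k,x})_{k\in\mathbb N,\,x\in E}$ be probability measures on $\Omega$ such that under $\mathbb P_{k,x}$ the process $(X_n)$ is a Markov process with respect to $(\mathcal F_n)$ with transition kernel $P$ and $X_0=x$ almost surely. Let $\phi:\mathbb N\to[0,1]$ (with $\mathbb N=\{0,1,2,\dots\}$) be nonincreasing with $\phi(0)=1$, $\phi(n+k)\ge\phi(n)\phi(k)$ for all $n,k\in\mathbb N$, and $\sum_{i=0}^\infty\phi(i)=\infty$. For $k\in\mathbb N$ and $n\ge 1$ define the weighted empirical measure $$S_k^n=\Big(\sum_{i=k}^{n+k-1}\phi(i)\Big)^{-1}\sum_{i=k}^{n+k-1}\phi(i)\,\delta_{X_{i-k}}\in\mathcal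 P(E),$$ and for $\nu\in\mathcal P(E)$ let $$I(\nu)=\sup_{f}\int_E\ln\frac{f(x)}{Pf(x)}\,\nu(dx)\in[0,\infty],$$ the supremum being over all $f\in C(E)$ for which there is $a>0$ with $f\ge a$ on $E$. Consider the condition (D.1): there are $\eta\in\mathcal P(E)$, a function $p:E\times E\to\mathbb R$ with $p(x,\cdot)$ Borel measurable for every $x\in E$, and a constant $M>0$ such that $P(x,B)=\int_B p(x,y)\,\eta(dy)$ for all $x\in E$ and all Borel $B\subset E$, the map $x\mapsto p(x,y)$ is continuous for every $y\in E$, and $\frac1M\le p(x,y)\le M$ for all $x,y\in E$. Theorem. Let $C\subset\mathcal P(E)$ be compact, or let $C$ be closed and assume (D.1). Then for every $k\in\mathbb N$ $$\limsup_{n\to\infty}\Big(\sum_{i=k}^{n+k-1}\phi(i)\Big)^{-1}\sup_{x\in E}\ln \mathbb P_{k,x}\big(S_k^n\in C\big)\;\le\;-\inf_{\nu\in C}I(\nu),$$ where $\ln 0=-\infty$ and $\inf\emptyset=+\infty$. -/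

import Mathlib

open MeasureTheory ProbabilityTheory Filter Topology
open scoped ENNReal BoundedContinuousFunction

noncomputable section

namespace DiscountedLDP

/-- A generalized discount factor `φ : ℕ → [0, 1]`: `φ 0 = 1`, `φ` is nonincreasing,
`φ (n + k) ≥ φ n * φ k`, and the series `∑ φ k` diverges. -/
structure IsDiscountFactor (φ : ℕ → ℝ) : Prop where
  mem_unit : ∀ n, φ n ∈ Set.Icc (0 : ℝ) 1
  zero : φ 0 = 1
  antitone : Antitone φ
  supermul : ∀ n k, φ n * φ k ≤ φ (n + k)
  diverges : Tendsto (fun n => ∑ i ∈ Finset.range n, φ i) atTop atTop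

/-- The total weight `∑_{i=k}^{n+k-1} φ i`. -/
def totalWeight (φ : ℕ → ℝ) (k n : ℕ) : ℝ := ∑ i ∈ Finset.Ico k (n + k), φ i

section Chain

variable {E : Type*} [MeasurableSpace E] {Ω : Type*} [mΩ : MeasurableSpace Ω]

/-- Under `μ`, the process `(X n)` is a time-homogeneous Markov process with respect to the
filtration `ℱ`, with transition kernel `P`, started from the point `x`. -/
structure IsMarkovChainFrom (P : Kernel E E) (ℱ : Filtration ℕ mΩ)
    (X : ℕ → Ω → E) (μ : Measure Ω) (x : E) : Prop where
  isProbabilityMeasure : IsProbabilityMeasure μ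
  adapted : ∀ n, Measurable[ℱ n] (X n)
  start : ∀ᵐ ω ∂μ, X 0 ω = x
  markov : ∀ n, ∀ B : Set E, MeasurableSet B →
    μ[(X (n + 1) ⁻¹' B).indicator (fun _ => (1 : ℝ)) | ℱ n] =ᵐ[μ] fun ω => (P (X n ω)).real B

/-- The weighted empirical measure
`S_k^n = (∑_{i=k}^{n+k-1} φ i)⁻¹ ∑_{i=k}^{n+k-1} φ i δ_{X_{i-k}}`.
It is a probability measure for `n ≥ 1`, and the zero measure for `n = 0`. -/
def weightedEmpirical (φ : ℕ → ℝ) (X : ℕ → Ω → E) (k n : ℕ) (ω : Ω) : Measure E :=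
  ENNReal.ofReal (totalWeight φ k n)⁻¹ •
    ∑ i ∈ Finset.Ico k (n + k), ENNReal.ofReal (φ i) • Measure.dirac (X (i - k) ω)

/-- `Q(D) = μ {S_k^n ∈ D}` for a set `D` of probability measures. -/
def empiricalLaw (φ : ℕ → ℝ) (X : ℕ → Ω → E) (μ : Measure Ω) (k n : ℕ)
    (D : Set (ProbabilityMeasure E)) : ℝ≥0∞ :=
  μ {ω | ∃ ν ∈ D, (ν : Measure E) = weightedEmpirical φ X k n ω}

end Chain

section Topological

variable {E : Type*} [TopologicalSpace E] [MeasurableSpace E]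

/-- The Feller property `P C(E) ⊆ C(E)`, with `C(E)` the bounded continuous functions. -/
def IsFeller (P : Kernel E E) : Prop :=
  ∀ f : E →ᵇ ℝ, Continuous fun x => ∫ y, f y ∂(P x)

/-- The rate functional `I(ν) = sup_f ∫ ln (f / P f) dν`, the supremum over all bounded continuous
`f` that are bounded below by a positive constant. -/
def rate (P : Kernel E E) (ν : ProbabilityMeasure E) : EReal :=
  ⨆ f ∈ {f : E →ᵇ ℝ | ∃ a > 0, ∀ x, a ≤ f x},
    ((∫ x, Real.log (f x / ∫ y, f y ∂(P x)) ∂(ν : Measure E) : ℝ) : EReal)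

/-- The density condition: for some probability measure `η`, every `P x` has a density `p x` with
respect to `η`, continuous in `x`, with `1 / M ≤ p ≤ M` for a constant `M > 0`. -/
def DensityCondition (P : Kernel E E) : Prop :=
  ∃ (η : ProbabilityMeasure E) (p : E → E → ℝ),
    (∀ x, Measurable (p x)) ∧
    (∀ x, ∀ B : Set E, MeasurableSet B →
      P x B = ∫⁻ y in B, ENNReal.ofReal (p x y) ∂(η : Measure E)) ∧
    (∀ y, Continuous fun x => p x y) ∧
    ∃ M > 0, ∀ x y, 1 / M ≤ p x y ∧ p x y ≤ M

end Topological

end DiscountedLDP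

end

/-! For a test function f, the products of f(X_{i+1}) / Pf(X_i) form a mean-one martingale. Raising
the factors to powers φ(k+i) in [0,1] gives, by Jensen, a supermartingale, so the sum of φ(k+i) (ln
f(X_{i+1}) - ln Pf(X_i)) exceeds t with probability at most exp(-t). As φ is nonincreasing,
summation by parts replaces f(X_{i+1}) by f(X_i) at a bounded cost. With W the total weight, ∫
ln(f/Pf) dS > b thus has probability at most exp(c - bW), uniformly in the starting point
(`IsTestFunction.exists_empiricalLaw_rateHalfspace_le`).

If b < I on C, the corresponding half-spaces, open by the Feller property, cover C. When C is
compact finitely many suffice, and their constants disappear on dividing the logarithm by W → ∞.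

For closed C, (D.1) makes the kernels uniformly tight, and the same exponential bound applied to
indicators gives exponential tightness. The starting point ranges over all of E, so no compact set
controls its atom; that atom is moved to a fixed x₀, which changes integrals by O(1/W)
(`IsDiscountFactor.eventually_mem_of_update_mem`). -/

namespace DiscountedLDP

/-! ### Markov property and the exponential supermartingale -/

section Markov

variable {E : Type*} [MeasurableSpace E] {Ω : Type*} [mΩ : MeasurableSpace Ω]
  {P : Kernel E E} {ℱ : Filtration ℕ mΩ} {X : ℕ → Ω → E} {μ : Measure Ω} {x : E}

lemma IsMarkovChainFrom.measurable (h : IsMarkovChainFrom P ℱ X μ x) (n : ℕ) :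
    Measurable (X n) :=
  (h.adapted n).mono (ℱ.le n) le_rfl

lemma IsMarkovChainFrom.measure_inter_preimage [IsMarkovKernel P]
    (h : IsMarkovChainFrom P ℱ X μ x) (n : ℕ) {A : Set Ω} (hA : MeasurableSet[ℱ n] A)
    {B : Set E} (hB : MeasurableSet B) :
    μ (A ∩ X (n + 1) ⁻¹' B) = ∫⁻ ω in A, P (X n ω) B ∂μ := by
  have := h.isProbabilityMeasure
  have hpre : MeasurableSet (X (n + 1) ⁻¹' B) := h.measurable (n + 1) hB
  have hint : Integrable ((X (n + 1) ⁻¹' B).indicator fun _ => (1 : ℝ)) μ :=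
    (integrable_const 1).indicator hpre
  have key := setIntegral_condExp (ℱ.le n) hint hA
  have h1 : ∫ ω in A, (X (n + 1) ⁻¹' B).indicator (fun _ => (1 : ℝ)) ω ∂μ
      = μ.real (A ∩ X (n + 1) ⁻¹' B) := by
    rw [integral_indicator_const _ hpre, smul_eq_mul, mul_one,
      measureReal_restrict_apply hpre, Set.inter_comm]
  have h2 : ∫ ω in A, (μ[(X (n + 1) ⁻¹' B).indicator (fun _ => (1 : ℝ)) | ℱ n]) ω ∂μ
      = ∫ ω in A, (P (X n ω)).real B ∂μ :=
    integral_congr_ae (ae_restrict_of_ae (h.markov n B hB))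
  rw [h1, h2] at key
  have hmeas : Measurable fun ω => P (X n ω) B :=
    (Kernel.measurable_coe P hB).comp (h.measurable n)
  have h3 : ∫ ω in A, (P (X n ω)).real B ∂μ = (∫⁻ ω in A, P (X n ω) B ∂μ).toReal :=
    integral_toReal hmeas.aemeasurable (Eventually.of_forall fun ω => measure_lt_top _ _)
  rw [h3] at key
  refine ((ENNReal.toReal_eq_toReal_iff' ?_ (measure_ne_top _ _)).1 key).symm
  refine ne_top_of_le_ne_top (measure_ne_top μ A) ?_
  calc ∫⁻ ω in A, P (X n ω) B ∂μ ≤ ∫⁻ _ in A, 1 ∂μ := lintegral_mono fun ω => prob_le_one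
    _ = μ A := by simp

lemma IsMarkovChainFrom.setLIntegral_comp_succ [IsMarkovKernel P]
    (h : IsMarkovChainFrom P ℱ X μ x) (n : ℕ) {A : Set Ω} (hA : MeasurableSet[ℱ n] A)
    {g : E → ℝ≥0∞} (hg : Measurable g) :
    ∫⁻ ω in A, g (X (n + 1) ω) ∂μ = ∫⁻ ω in A, ∫⁻ y, g y ∂(P (X n ω)) ∂μ := by
  have hX := h.measurable (n + 1)
  have hgX {g : E → ℝ≥0∞} (hg : Measurable g) : Measurable fun ω => g (X (n + 1) ω) := hg.comp hX
  have hm {g : E → ℝ≥0∞} (hg : Measurable g) : Measurable fun ω => ∫⁻ y, g y ∂(P (X n ω)) :=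
    hg.lintegral_kernel.comp (h.measurable n)
  refine Measurable.ennreal_induction (motive := fun g => ∫⁻ ω in A, g (X (n + 1) ω) ∂μ
    = ∫⁻ ω in A, ∫⁻ y, g y ∂(P (X n ω)) ∂μ) ?_ ?_ ?_ hg
  · intro c B hB
    have h1 : (fun ω => B.indicator (fun _ => c) (X (n + 1) ω))
        = (X (n + 1) ⁻¹' B).indicator fun _ => c := rfl
    rw [h1, lintegral_indicator_const (hX hB), Measure.restrict_apply (hX hB), Set.inter_comm,
      h.measure_inter_preimage n hA hB]
    simp_rw [lintegral_indicator_const hB]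
    have hPB : Measurable fun ω => P (X n ω) B :=
      (Kernel.measurable_coe P hB).comp (h.measurable n)
    rw [lintegral_const_mul _ hPB]
  · intro f g _ hf hg hf' hg'
    simp only [Pi.add_apply]
    rw [lintegral_add_left (hgX hf), hf', hg', ← lintegral_add_left (hm hf)]
    refine lintegral_congr fun ω => ?_
    rw [lintegral_add_left hf]
  · intro f hf hmono h'
    rw [lintegral_iSup (fun i => hgX (hf i)) fun i j hij ω => hmono hij _]
    simp_rw [lintegral_iSup hf hmono]
    rw [lintegral_iSup (fun i => hm (hf i)) fun i j hij ω => lintegral_mono (hmono hij)]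
    exact iSup_congr h'

lemma IsMarkovChainFrom.lintegral_mul_comp_succ [IsMarkovKernel P]
    (h : IsMarkovChainFrom P ℱ X μ x) (n : ℕ) {Z : Ω → ℝ≥0∞} (hZ : Measurable[ℱ n] Z)
    {g : E → ℝ≥0∞} (hg : Measurable g) :
    ∫⁻ ω, Z ω * g (X (n + 1) ω) ∂μ = ∫⁻ ω, Z ω * ∫⁻ y, g y ∂(P (X n ω)) ∂μ := by
  have hgX : Measurable fun ω => g (X (n + 1) ω) := hg.comp (h.measurable (n + 1))
  have hm : Measurable fun ω => ∫⁻ y, g y ∂(P (X n ω)) :=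
    hg.lintegral_kernel.comp (h.measurable n)
  have hmul {f v : Ω → ℝ≥0∞} (hf : Measurable f) (hv : Measurable v) :
      Measurable fun ω => f ω * v ω := hf.mul hv
  refine @Measurable.ennreal_induction Ω (ℱ n) (fun Z => ∫⁻ ω, Z ω * g (X (n + 1) ω) ∂μ
    = ∫⁻ ω, Z ω * ∫⁻ y, g y ∂(P (X n ω)) ∂μ) ?_ ?_ ?_ Z hZ
  · intro c A hA
    have hA' := ℱ.le n A hA
    have h1 (v : Ω → ℝ≥0∞) (ω : Ω) :
        A.indicator (fun _ => c) ω * v ω = A.indicator (fun ω => c * v ω) ω := by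
      by_cases hω : ω ∈ A <;> simp [hω]
    rw [lintegral_congr (h1 _), lintegral_congr (h1 _), lintegral_indicator hA',
      lintegral_indicator hA', lintegral_const_mul _ hgX,
      lintegral_const_mul _ hm, h.setLIntegral_comp_succ n hA hg]
  · intro f g _ hf hg hf' hg'
    have hf1 := hf.mono (ℱ.le n) le_rfl
    simp only [Pi.add_apply, add_mul]
    rw [lintegral_add_left (hmul hf1 hgX), hf', hg', ← lintegral_add_left (hmul hf1 hm)]
  · intro f hf hmono h'
    have hf1 := fun i => (hf i).mono (ℱ.le n) le_rfl
    simp only [ENNReal.iSup_mul]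
    rw [lintegral_iSup (fun i => hmul (hf1 i) hgX) fun i j hij ω => mul_left_mono (hmono hij _),
      lintegral_iSup (fun i => hmul (hf1 i) hm) fun i j hij ω => mul_left_mono (hmono hij _)]
    exact iSup_congr h'

/-- Jensen's inequality for `t ↦ t ^ w` with `w ∈ [0, 1]`, in exponential form. -/
lemma lintegral_exp_mul_le {ν : Measure E} [IsProbabilityMeasure ν] {a : E → ℝ}
    (ha : Measurable a) {b w : ℝ} (hw : w ∈ Set.Icc (0 : ℝ) 1)
    (hab : ∫⁻ y, ENNReal.ofReal (Real.exp (a y)) ∂ν ≤ ENNReal.ofReal (Real.exp b)) :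
    ∫⁻ y, ENNReal.ofReal (Real.exp (w * a y)) ∂ν ≤ ENNReal.ofReal (Real.exp (w * b)) := by
  -- The concave function s ↦ s ^ w lies below its tangent at s = 1; here s = exp (t - b).
  have hpt (t : ℝ) : Real.exp (w * t) ≤
      Real.exp (w * b) * ((1 - w) + w * Real.exp (-b) * Real.exp t) := by
    have h1 := rpow_one_add_le_one_add_mul_self
      (s := Real.exp (t - b) - 1) (by linarith [Real.exp_pos (t - b)]) hw.1 hw.2
    rw [add_sub_cancel, ← Real.exp_mul] at h1
    have h2 : Real.exp (w * t) = Real.exp (w * b) * Real.exp ((t - b) * w) := by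
      rw [← Real.exp_add]; ring_nf
    have h3 : Real.exp (t - b) = Real.exp (-b) * Real.exp t := by
      rw [← Real.exp_add]; ring_nf
    rw [h2]
    rw [h3] at h1
    refine mul_le_mul_of_nonneg_left ?_ (Real.exp_pos _).le
    linarith
  have hw1 : 0 ≤ 1 - w := by linarith [hw.2]
  have hwb : 0 ≤ w * Real.exp (-b) := mul_nonneg hw.1 (Real.exp_pos _).le
  have hm : Measurable fun y => ENNReal.ofReal (Real.exp (a y)) := by fun_prop
  calc ∫⁻ y, ENNReal.ofReal (Real.exp (w * a y)) ∂ν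
      ≤ ∫⁻ y, ENNReal.ofReal (Real.exp (w * b)) * (ENNReal.ofReal (1 - w)
          + ENNReal.ofReal (w * Real.exp (-b)) * ENNReal.ofReal (Real.exp (a y))) ∂ν := by
        refine lintegral_mono fun y => ?_
        rw [← ENNReal.ofReal_mul hwb, ← ENNReal.ofReal_add hw1
          (mul_nonneg hwb (Real.exp_pos _).le), ← ENNReal.ofReal_mul (Real.exp_pos _).le]
        exact ENNReal.ofReal_le_ofReal (hpt _)
    _ = ENNReal.ofReal (Real.exp (w * b)) * (ENNReal.ofReal (1 - w)
          + ENNReal.ofReal (w * Real.exp (-b)) * ∫⁻ y, ENNReal.ofReal (Real.exp (a y)) ∂ν) := by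
        rw [lintegral_const_mul _ (by fun_prop), lintegral_add_left (by fun_prop),
          lintegral_const_mul _ hm, lintegral_const, measure_univ, mul_one]
    _ ≤ ENNReal.ofReal (Real.exp (w * b)) * (ENNReal.ofReal (1 - w)
          + ENNReal.ofReal (w * Real.exp (-b)) * ENNReal.ofReal (Real.exp b)) := by gcongr
    _ = ENNReal.ofReal (Real.exp (w * b)) := by
        rw [← ENNReal.ofReal_mul hwb, ← ENNReal.ofReal_add hw1
          (mul_nonneg hwb (Real.exp_pos _).le), ← ENNReal.ofReal_mul (Real.exp_pos _).le,
          mul_assoc, ← Real.exp_add]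
        simp

/-- Supermartingale property: given the past up to time n, the last factor has conditional mean at
most 1, by Jensen with exponent `w n`. -/
lemma IsMarkovChainFrom.lintegral_exp_sum_le_one [IsMarkovKernel P]
    (h : IsMarkovChainFrom P ℱ X μ x) {a b : E → ℝ} (ha : Measurable a) (hb : Measurable b)
    (hab : ∀ z, ∫⁻ y, ENNReal.ofReal (Real.exp (a y)) ∂(P z) ≤ ENNReal.ofReal (Real.exp (b z)))
    {w : ℕ → ℝ} (hw : ∀ i, w i ∈ Set.Icc (0 : ℝ) 1) (n : ℕ) :
    ∫⁻ ω, ENNReal.ofReal (Real.exp (∑ i ∈ Finset.range n, w i * (a (X (i + 1) ω) - b (X i ω)))) ∂μ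
      ≤ 1 := by
  have := h.isProbabilityMeasure
  induction n with
  | zero => simp
  | succ n ih =>
    have hX (i : ℕ) (hi : i ≤ n) : Measurable[ℱ n] (X i) :=
      (h.adapted i).mono (ℱ.mono hi) le_rfl
    have hS : Measurable[ℱ n]
        fun ω => ∑ i ∈ Finset.range n, w i * (a (X (i + 1) ω) - b (X i ω)) := by
      refine Finset.measurable_sum _ fun i hi => ?_
      have hi' := Finset.mem_range.1 hi
      exact ((ha.comp (hX _ hi')).sub (hb.comp (hX _ hi'.le))).const_mul _
    have hZ : Measurable[ℱ n] fun ω => ENNReal.ofReal (Real.exp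
        (∑ i ∈ Finset.range n, w i * (a (X (i + 1) ω) - b (X i ω)) - w n * b (X n ω))) :=
      (Real.measurable_exp.comp (hS.sub ((hb.comp (hX n le_rfl)).const_mul _))).ennreal_ofReal
    have hg : Measurable fun y => ENNReal.ofReal (Real.exp (w n * a y)) := by fun_prop
    calc _ = ∫⁻ ω, ENNReal.ofReal (Real.exp
        (∑ i ∈ Finset.range n, w i * (a (X (i + 1) ω) - b (X i ω)) - w n * b (X n ω)))
          * ENNReal.ofReal (Real.exp (w n * a (X (n + 1) ω))) ∂μ := by
          refine lintegral_congr fun ω => ?_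
          rw [← ENNReal.ofReal_mul (Real.exp_pos _).le, ← Real.exp_add, Finset.sum_range_succ]
          congr 2; ring
      _ = _ := h.lintegral_mul_comp_succ n hZ hg
      _ ≤ ∫⁻ ω, ENNReal.ofReal (Real.exp
        (∑ i ∈ Finset.range n, w i * (a (X (i + 1) ω) - b (X i ω)) - w n * b (X n ω)))
          * ENNReal.ofReal (Real.exp (w n * b (X n ω))) ∂μ := by
          refine lintegral_mono fun ω => ?_
          dsimp only
          gcongr
          exact lintegral_exp_mul_le ha (hw n) (hab _)
      _ ≤ 1 := by
          refine le_trans (le_of_eq (lintegral_congr fun ω => ?_)) ih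
          rw [← ENNReal.ofReal_mul (Real.exp_pos _).le, ← Real.exp_add, sub_add_cancel]

/-- Exponential Chebyshev inequality for the weighted additive functional. -/
lemma IsMarkovChainFrom.measure_lt_sum_le [IsMarkovKernel P]
    (h : IsMarkovChainFrom P ℱ X μ x) {a b : E → ℝ} (ha : Measurable a) (hb : Measurable b)
    (hab : ∀ z, ∫⁻ y, ENNReal.ofReal (Real.exp (a y)) ∂(P z) ≤ ENNReal.ofReal (Real.exp (b z)))
    {w : ℕ → ℝ} (hw : ∀ i, w i ∈ Set.Icc (0 : ℝ) 1) (n : ℕ) (t : ℝ) :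
    μ {ω | t < ∑ i ∈ Finset.range n, w i * (a (X (i + 1) ω) - b (X i ω))}
      ≤ ENNReal.ofReal (Real.exp (-t)) := by
  have hX := h.measurable
  have hm : Measurable fun ω => ENNReal.ofReal (Real.exp
      (∑ i ∈ Finset.range n, w i * (a (X (i + 1) ω) - b (X i ω)))) := by fun_prop
  have h1 := (mul_meas_ge_le_lintegral hm (ENNReal.ofReal (Real.exp t))).trans
    (h.lintegral_exp_sum_le_one ha hb hab hw n)
  have h2 : μ {ω | t < ∑ i ∈ Finset.range n, w i * (a (X (i + 1) ω) - b (X i ω))}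
      ≤ μ {ω | ENNReal.ofReal (Real.exp t) ≤ ENNReal.ofReal (Real.exp
      (∑ i ∈ Finset.range n, w i * (a (X (i + 1) ω) - b (X i ω))))} :=
    measure_mono fun ω hω => ENNReal.ofReal_le_ofReal (Real.exp_le_exp.2 (le_of_lt hω))
  rw [Real.exp_neg, ENNReal.ofReal_inv_of_pos (Real.exp_pos _), ENNReal.le_inv_iff_mul_le,
    mul_comm]
  exact (mul_le_mul_right h2 _).trans h1

end Markov

/-- Summation by parts. The boundary term `w n * (c + a n)` is kept because it makes the induction
close: lowering `w n` to `w (n + 1)` only increases the bound. -/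
lemma sum_mul_sub_succ_le {w a : ℕ → ℝ} {c : ℝ} (hw : Antitone w) (h0 : 0 ≤ w 0) (ha : ∀ i, |a i| ≤ c)
    (n : ℕ) : ∑ i ∈ Finset.range n, w i * (a i - a (i + 1)) ≤ 2 * c * w 0 - w n * (c + a n) := by
  induction n with
  | zero =>
    have h1 := abs_le.1 (ha 0)
    simp only [Finset.range_zero, Finset.sum_empty]
    nlinarith [mul_nonneg h0 (by linarith : 0 ≤ c - a 0)]
  | succ n ih =>
    rw [Finset.sum_range_succ]
    have h1 := abs_le.1 (ha (n + 1))
    have h2 := hw (Nat.le_succ n)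
    nlinarith [mul_nonneg (sub_nonneg.2 h2) (by linarith : 0 ≤ c + a (n + 1))]

/-! ### Positivity and divergence of the weights -/

section Weights

variable {φ : ℕ → ℝ}

lemma IsDiscountFactor.pos (hφ : IsDiscountFactor φ) (n : ℕ) : 0 < φ n := by
  refine lt_of_le_of_ne (hφ.mem_unit n).1 fun h0 => ?_
  have hz (m : ℕ) (hm : n ≤ m) : φ m = 0 :=
    le_antisymm ((hφ.antitone hm).trans h0.ge) (hφ.mem_unit m).1
  -- A zero of φ would make all later terms vanish and the partial sums eventually constant.
  refine not_tendsto_const_atTop (∑ i ∈ Finset.range n, φ i) (atTop : Filter ℕ)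
    (hφ.diverges.congr' ?_)
  filter_upwards [eventually_ge_atTop n] with m hm
  rw [← Finset.sum_range_add_sum_Ico _ hm,
    Finset.sum_eq_zero fun i hi => hz i (Finset.mem_Ico.1 hi).1, add_zero]

lemma totalWeight_eq_sum_range (φ : ℕ → ℝ) (k n : ℕ) :
    totalWeight φ k n = ∑ i ∈ Finset.range n, φ (k + i) := by
  rw [totalWeight, Finset.sum_Ico_eq_sum_range, Nat.add_sub_cancel]

lemma IsDiscountFactor.tendsto_totalWeight (hφ : IsDiscountFactor φ) (k : ℕ) :
    Tendsto (fun n => totalWeight φ k n) atTop atTop := by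
  have h (n : ℕ) : totalWeight φ k n
      = -(∑ i ∈ Finset.range k, φ i) + ∑ i ∈ Finset.range (n + k), φ i := by
    rw [totalWeight, ← Finset.sum_range_add_sum_Ico _ (Nat.le_add_left k n)]
    ring
  simp_rw [h]
  exact tendsto_atTop_add_const_left _ _ (hφ.diverges.comp (tendsto_add_atTop_nat k))

lemma IsDiscountFactor.totalWeight_pos (hφ : IsDiscountFactor φ) (k : ℕ) {n : ℕ} (hn : 0 < n) :
    0 < totalWeight φ k n := by
  rw [totalWeight_eq_sum_range]
  exact Finset.sum_pos (fun i _ => hφ.pos _) ⟨0, Finset.mem_range.2 hn⟩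

end Weights

/-! ### Weighted empirical measures of paths -/

section Empirical

variable {E : Type*} [MeasurableSpace E] {φ : ℕ → ℝ}

/-- The weighted empirical measure of a deterministic path. -/
noncomputable def pathEmpirical (φ : ℕ → ℝ) (k n : ℕ) (y : ℕ → E) : Measure E :=
  weightedEmpirical φ (fun i (y : ℕ → E) => y i) k n y

lemma weightedEmpirical_eq_pathEmpirical {Ω : Type*} [MeasurableSpace Ω] (φ : ℕ → ℝ)
    (X : ℕ → Ω → E) (k n : ℕ) (ω : Ω) :
    weightedEmpirical φ X k n ω = pathEmpirical φ k n fun i => X i ω := rfl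

lemma pathEmpirical_eq_sum_range (φ : ℕ → ℝ) (k n : ℕ) (y : ℕ → E) :
    pathEmpirical φ k n y = ENNReal.ofReal (totalWeight φ k n)⁻¹ •
      ∑ i ∈ Finset.range n, ENNReal.ofReal (φ (k + i)) • Measure.dirac (y i) := by
  rw [pathEmpirical, weightedEmpirical, Finset.sum_Ico_eq_sum_range, Nat.add_sub_cancel]
  simp only [Nat.add_sub_cancel_left]

lemma IsDiscountFactor.pathEmpirical_apply (hφ : IsDiscountFactor φ) (k n : ℕ) (y : ℕ → E)
    {B : Set E} (hB : MeasurableSet B) :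
    pathEmpirical φ k n y B = ENNReal.ofReal ((totalWeight φ k n)⁻¹ *
      ∑ i ∈ Finset.range n, φ (k + i) * B.indicator (fun _ => (1 : ℝ)) (y i)) := by
  have hW : 0 ≤ totalWeight φ k n := Finset.sum_nonneg fun i _ => (hφ.pos i).le
  have hi (z : E) : 0 ≤ B.indicator (fun _ => (1 : ℝ)) z :=
    Set.indicator_nonneg (fun _ _ => zero_le_one) _
  rw [pathEmpirical_eq_sum_range, Measure.smul_apply, Measure.finsetSum_apply,
    ENNReal.ofReal_mul (inv_nonneg.2 hW),
    ENNReal.ofReal_sum_of_nonneg fun i _ => mul_nonneg (hφ.pos _).le (hi _), smul_eq_mul]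
  congr 1
  refine Finset.sum_congr rfl fun i _ => ?_
  rw [Measure.smul_apply, Measure.dirac_apply' _ hB, smul_eq_mul,
    ENNReal.ofReal_mul (hφ.pos _).le]
  by_cases h : y i ∈ B <;> simp [h]

lemma IsDiscountFactor.isProbabilityMeasure_pathEmpirical (hφ : IsDiscountFactor φ) (k : ℕ) {n : ℕ}
    (hn : 0 < n) (y : ℕ → E) : IsProbabilityMeasure (pathEmpirical φ k n y) := by
  refine ⟨?_⟩
  rw [hφ.pathEmpirical_apply k n y MeasurableSet.univ]
  simp only [Set.indicator_univ, mul_one]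
  rw [← totalWeight_eq_sum_range, inv_mul_cancel₀ (hφ.totalWeight_pos k hn).ne',
    ENNReal.ofReal_one]

lemma IsDiscountFactor.integral_pathEmpirical [TopologicalSpace E] [OpensMeasurableSpace E]
    (hφ : IsDiscountFactor φ) (k n : ℕ) (y : ℕ → E) (g : E →ᵇ ℝ) :
    ∫ z, g z ∂(pathEmpirical φ k n y)
      = (totalWeight φ k n)⁻¹ * ∑ i ∈ Finset.range n, φ (k + i) * g (y i) := by
  have hW : 0 ≤ totalWeight φ k n := Finset.sum_nonneg fun i _ => (hφ.pos i).le
  have hg : StronglyMeasurable fun z => g z := g.continuous.measurable.stronglyMeasurable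
  rw [pathEmpirical_eq_sum_range, integral_smul_measure, integral_finsetSum_measure,
    ENNReal.toReal_ofReal (inv_nonneg.2 hW), smul_eq_mul]
  · congr 1
    refine Finset.sum_congr rfl fun i _ => ?_
    rw [integral_smul_measure, integral_dirac' _ _ hg, ENNReal.toReal_ofReal (hφ.pos _).le,
      smul_eq_mul]
  · intro i _
    exact (g.integrable _).smul_measure ENNReal.ofReal_ne_top

end Empirical

/-! ### Half-spaces defined by test functions and their probabilities -/

section Rate

variable {E : Type*} [TopologicalSpace E]

/-- Bounded continuous functions bounded below by a positive constant. -/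
def IsTestFunction (f : E →ᵇ ℝ) : Prop := ∃ a > 0, ∀ x, a ≤ f x

/-- The condition on `t` holds both for values of f and for values of Pf, so one constant serves
both logarithms. -/
lemma IsTestFunction.exists_abs_log_le {f : E →ᵇ ℝ} (hf : IsTestFunction f) :
    ∃ c, ∀ t, (∀ a, (∀ x, a ≤ f x) → a ≤ t) → t ≤ ‖f‖ → |Real.log t| ≤ c := by
  obtain ⟨a, ha, hfa⟩ := hf
  refine ⟨max |Real.log a| |Real.log ‖f‖|, fun t h1 h2 => ?_⟩
  have h := h1 a hfa
  exact abs_le_max_abs_abs (Real.log_le_log ha h) (Real.log_le_log (ha.trans_le h) h2)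

lemma IsTestFunction.continuous_log {f : E →ᵇ ℝ} (hf : IsTestFunction f) :
    Continuous fun x => Real.log (f x) := by
  obtain ⟨a, ha, hfa⟩ := hf
  exact f.continuous.log fun x => (ha.trans_le (hfa x)).ne'

variable [MeasurableSpace E] [OpensMeasurableSpace E] {P : Kernel E E} [IsMarkovKernel P]

lemma le_integral_of_le (f : E →ᵇ ℝ) {a : ℝ} (h : ∀ x, a ≤ f x) (z : E) :
    a ≤ ∫ y, f y ∂(P z) := by
  calc a = ∫ _, a ∂(P z) := by simp
    _ ≤ _ := integral_mono (integrable_const _) (f.integrable _) h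

lemma integral_le_norm (f : E →ᵇ ℝ) (z : E) : ∫ y, f y ∂(P z) ≤ ‖f‖ := by
  calc _ ≤ ∫ _, ‖f‖ ∂(P z) := integral_mono (f.integrable _) (integrable_const _)
        fun x => (le_abs_self _).trans (f.norm_coe_le_norm x)
    _ = ‖f‖ := by simp

lemma IsTestFunction.abs_logs_le {f : E →ᵇ ℝ} (hf : IsTestFunction f) :
    ∃ c, (∀ x, |Real.log (f x)| ≤ c) ∧ ∀ x, |Real.log (∫ y, f y ∂(P x))| ≤ c := by
  obtain ⟨c, hc⟩ := hf.exists_abs_log_le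
  exact ⟨c, fun x => hc _ (fun a ha => ha x) ((le_abs_self _).trans (f.norm_coe_le_norm x)),
    fun x => hc _ (fun a ha => le_integral_of_le f ha x) (integral_le_norm f x)⟩

lemma IsTestFunction.log_div {f : E →ᵇ ℝ} (hf : IsTestFunction f) (x : E) :
    Real.log (f x / ∫ y, f y ∂(P x)) = Real.log (f x) - Real.log (∫ y, f y ∂(P x)) := by
  obtain ⟨a, ha, hfa⟩ := hf
  exact Real.log_div (ha.trans_le (hfa x)).ne' (ha.trans_le (le_integral_of_le f hfa x)).ne'

lemma IsTestFunction.continuous_log_integral (hP : IsFeller P) {f : E →ᵇ ℝ}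
    (hf : IsTestFunction f) : Continuous fun x => Real.log (∫ y, f y ∂(P x)) := by
  obtain ⟨a, ha, hfa⟩ := hf
  exact (hP f).log fun x => (ha.trans_le (le_integral_of_le f hfa x)).ne'

lemma IsTestFunction.exists_boundedContinuous (hP : IsFeller P) {f : E →ᵇ ℝ}
    (hf : IsTestFunction f) :
    ∃ V : E →ᵇ ℝ, ∀ x, V x = Real.log (f x / ∫ y, f y ∂(P x)) := by
  obtain ⟨c, h1, h2⟩ := hf.abs_logs_le (P := P)
  refine ⟨BoundedContinuousFunction.ofNormedAddCommGroup
    (fun x => Real.log (f x / ∫ y, f y ∂(P x))) ?_ (c + c) fun x => ?_, fun x => rfl⟩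
  · simp_rw [hf.log_div]
    exact hf.continuous_log.sub (hf.continuous_log_integral hP)
  · rw [hf.log_div]
    exact (norm_sub_le _ _).trans (add_le_add (h1 x) (h2 x))

/-- The half-space of measures on which the test function `f` certifies that the rate exceeds
`b`. -/
def rateHalfspace (P : Kernel E E) (b : ℝ) (f : E →ᵇ ℝ) : Set (ProbabilityMeasure E) :=
  {ν | b < ∫ x, Real.log (f x / ∫ y, f y ∂(P x)) ∂(ν : Measure E)}

lemma IsTestFunction.isOpen_rateHalfspace (hP : IsFeller P) {f : E →ᵇ ℝ} (hf : IsTestFunction f)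
    (b : ℝ) : IsOpen (rateHalfspace P b f) := by
  obtain ⟨V, hV⟩ := hf.exists_boundedContinuous hP
  simp_rw [rateHalfspace, ← hV]
  exact isOpen_lt continuous_const
    (ProbabilityMeasure.continuous_integral_boundedContinuousFunction V)

lemma exists_finset_rateHalfspace (hP : IsFeller P) {K : Set (ProbabilityMeasure E)}
    (hK : IsCompact K) {b : ℝ} (hb : ∀ ν ∈ K, (b : EReal) < rate P ν) :
    ∃ F : Finset {f : E →ᵇ ℝ // IsTestFunction f}, K ⊆ ⋃ f ∈ F, rateHalfspace P b f := by
  refine hK.elim_finite_subcover _ (fun f => f.2.isOpen_rateHalfspace hP b) fun ν hν => ?_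
  have h := hb ν hν
  simp only [rate, lt_iSup_iff] at h
  obtain ⟨f, hf, hlt⟩ := h
  exact Set.mem_iUnion.2 ⟨⟨f, hf⟩, EReal.coe_lt_coe_iff.1 hlt⟩

variable {φ : ℕ → ℝ} {Ω : Type*} [mΩ : MeasurableSpace Ω] {ℱ : Filtration ℕ mΩ} {X : ℕ → Ω → E}

/-- The sum of φ ln(f/Pf) along the path splits into a telescoping part, bounded by summation by
parts, and the part controlled by the exponential Chebyshev inequality. The constant depends on
neither the starting point nor n. -/
lemma IsTestFunction.exists_empiricalLaw_rateHalfspace_le (hP : IsFeller P)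
    (hφ : IsDiscountFactor φ) {f : E →ᵇ ℝ} (hf : IsTestFunction f) (b : ℝ) (k : ℕ) :
    ∃ c, ∀ (μ : Measure Ω) (x : E), IsMarkovChainFrom P ℱ X μ x → ∀ n > 0,
      empiricalLaw φ X μ k n (rateHalfspace P b f)
        ≤ ENNReal.ofReal (Real.exp (c - b * totalWeight φ k n)) := by
  obtain ⟨c, h1, h2⟩ := hf.abs_logs_le (P := P)
  obtain ⟨V, hV⟩ := hf.exists_boundedContinuous hP
  refine ⟨2 * c * φ k, fun μ x hμ n hn => ?_⟩
  have hab (z : E) : ∫⁻ y, ENNReal.ofReal (Real.exp (Real.log (f y))) ∂(P z)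
      ≤ ENNReal.ofReal (Real.exp (Real.log (∫ y, f y ∂(P z)))) := by
    obtain ⟨a, ha, hfa⟩ := hf
    rw [Real.exp_log (ha.trans_le (le_integral_of_le f hfa z)),
      ofReal_integral_eq_lintegral_ofReal (f.integrable _)
        (Eventually.of_forall fun y => (ha.trans_le (hfa y)).le)]
    exact lintegral_mono fun y => by rw [Real.exp_log (ha.trans_le (hfa y))]
  have key := hμ.measure_lt_sum_le hf.continuous_log.measurable
    (hf.continuous_log_integral hP).measurable hab (w := fun i => φ (k + i))
    (fun i => hφ.mem_unit _) n (b * totalWeight φ k n - 2 * c * φ k)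
  rw [neg_sub] at key
  refine le_trans (measure_mono ?_) key
  rintro ω ⟨ν, hν, hνω⟩
  rw [rateHalfspace, Set.mem_ofPred_eq, hνω, weightedEmpirical_eq_pathEmpirical] at hν
  simp_rw [← hV] at hν
  rw [hφ.integral_pathEmpirical, lt_inv_mul_iff₀ (hφ.totalWeight_pos k hn)] at hν
  have habel := sum_mul_sub_succ_le (w := fun i => φ (k + i))
    (a := fun i => Real.log (f (X i ω))) (fun i j hij => hφ.antitone (by omega))
    (hφ.pos _).le (fun i => h1 (X i ω)) n
  -- The boundary term of the summation by parts has a favourable sign and is dropped.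
  have hlow := mul_nonneg (hφ.pos (k + n)).le (by linarith [abs_le.1 (h1 (X n ω))] :
    0 ≤ c + Real.log (f (X n ω)))
  have hsum : ∑ i ∈ Finset.range n, φ (k + i) * V (X i ω)
      = ∑ i ∈ Finset.range n, φ (k + i) * (Real.log (f (X i ω)) - Real.log (f (X (i + 1) ω)))
      + ∑ i ∈ Finset.range n, φ (k + i) *
        (Real.log (f (X (i + 1) ω)) - Real.log (∫ y, f y ∂(P (X i ω)))) := by
    rw [← Finset.sum_add_distrib]
    refine Finset.sum_congr rfl fun i _ => ?_
    rw [hV, hf.log_div]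
    ring
  simp only [add_zero] at habel
  rw [Set.mem_ofPred_eq]
  linarith

end Rate

/-! ### Exponential bounds for the mass of a set -/

section Indicator

variable {E : Type*} [MeasurableSpace E]

/-- Provides the input of the exponential Chebyshev inequality with a = l 1_B and b = 1, since exp(l
1_B) ≤ 1 + e^l 1_B and 1 + 1 ≤ e. -/
lemma lintegral_exp_indicator_le {ν : Measure E} [IsProbabilityMeasure ν] {B : Set E}
    (hB : MeasurableSet B) {l : ℝ} (hl : ν B ≤ ENNReal.ofReal (Real.exp (-l))) :
    ∫⁻ y, ENNReal.ofReal (Real.exp (B.indicator (fun _ => l) y)) ∂ν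
      ≤ ENNReal.ofReal (Real.exp 1) := by
  calc ∫⁻ y, ENNReal.ofReal (Real.exp (B.indicator (fun _ => l) y)) ∂ν
      ≤ ∫⁻ y, 1 + B.indicator (fun _ => ENNReal.ofReal (Real.exp l)) y ∂ν := by
        refine lintegral_mono fun y => ?_
        by_cases hy : y ∈ B <;> simp [hy]
    _ = 1 + ENNReal.ofReal (Real.exp l) * ν B := by
        rw [lintegral_add_left measurable_const, lintegral_indicator_const hB]
        simp
    _ ≤ 1 + ENNReal.ofReal (Real.exp l) * ENNReal.ofReal (Real.exp (-l)) := by gcongr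
    _ = ENNReal.ofReal (1 + 1) := by
        rw [← ENNReal.ofReal_mul (Real.exp_pos _).le, ← Real.exp_add, add_neg_cancel,
          Real.exp_zero, ENNReal.ofReal_add zero_le_one zero_le_one, ENNReal.ofReal_one]
    _ ≤ ENNReal.ofReal (Real.exp 1) := ENNReal.ofReal_le_ofReal (Real.add_one_le_exp 1)

variable {P : Kernel E E} [IsMarkovKernel P] {φ : ℕ → ℝ} {Ω : Type*} [mΩ : MeasurableSpace Ω]
  {ℱ : Filtration ℕ mΩ} {X : ℕ → Ω → E} {μ : Measure Ω} {x : E}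

/-- The probability that the empirical measure, with the starting point moved into `Bᶜ`, gives
mass more than `t` to `B`. -/
lemma IsMarkovChainFrom.measure_pathEmpirical_update_gt_le (hφ : IsDiscountFactor φ)
    (h : IsMarkovChainFrom P ℱ X μ x) {B : Set E} (hB : MeasurableSet B) {l : ℝ} (hl : 0 ≤ l)
    (hPB : ∀ z, P z B ≤ ENNReal.ofReal (Real.exp (-l))) {x₀ : E} (hx₀ : x₀ ∉ B) (k : ℕ) {n : ℕ}
    (hn : 0 < n) {t : ℝ} (ht : 0 ≤ t) :
    μ {ω | ENNReal.ofReal t < pathEmpirical φ k n (Function.update (fun i => X i ω) 0 x₀) B}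
      ≤ ENNReal.ofReal (Real.exp (-(l * t - 1) * totalWeight φ k n)) := by
  have hW := hφ.totalWeight_pos k hn
  have key := h.measure_lt_sum_le (a := B.indicator fun _ => l) (b := fun _ => 1)
    (measurable_const.indicator hB) measurable_const
    (fun z => lintegral_exp_indicator_le hB (hPB z)) (w := fun i => φ (k + i))
    (fun i => hφ.mem_unit _) n ((l * t - 1) * totalWeight φ k n)
  rw [← neg_mul] at key
  -- For l = 0 the claimed bound is at least 1.
  rcases hl.eq_or_lt with rfl | hl
  · have := h.isProbabilityMeasure
    refine prob_le_one.trans ?_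
    rw [← ENNReal.ofReal_one]
    refine ENNReal.ofReal_le_ofReal (Real.one_le_exp ?_)
    linarith
  refine le_trans (measure_mono fun ω hω => ?_) key
  rw [Set.mem_ofPred_eq, hφ.pathEmpirical_apply _ _ _ hB, ENNReal.ofReal_lt_ofReal_iff_of_nonneg ht,
    lt_inv_mul_iff₀ hW] at hω
  have hi (z : E) : 0 ≤ B.indicator (fun _ => (1 : ℝ)) z :=
    Set.indicator_nonneg (fun _ _ => zero_le_one) _
  -- The time-0 term vanishes because x₀ ∉ B; each later visit is reindexed to a smaller, hence
  -- heavier, index.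
  have hshift : ∑ i ∈ Finset.range n, φ (k + i) *
        B.indicator (fun _ => (1 : ℝ)) (Function.update (fun i => X i ω) 0 x₀ i)
      ≤ ∑ i ∈ Finset.range n, φ (k + i) * B.indicator (fun _ => (1 : ℝ)) (X (i + 1) ω) := by
    obtain ⟨m, rfl⟩ := Nat.exists_eq_succ_of_ne_zero hn.ne'
    rw [Finset.sum_range_succ', Finset.sum_range_succ]
    refine add_le_add (Finset.sum_le_sum fun i _ => ?_) ?_
    · rw [Function.update_of_ne (Nat.succ_ne_zero i)]
      exact mul_le_mul_of_nonneg_right (hφ.antitone (by omega)) (hi _)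
    · rw [Function.update_self, Set.indicator_of_notMem hx₀, mul_zero]
      exact mul_nonneg (hφ.pos _).le (hi _)
  have hsum : ∑ i ∈ Finset.range n, φ (k + i) * (B.indicator (fun _ => l) (X (i + 1) ω) - 1)
      = l * ∑ i ∈ Finset.range n, φ (k + i) * B.indicator (fun _ => (1 : ℝ)) (X (i + 1) ω)
        - totalWeight φ k n := by
    rw [totalWeight_eq_sum_range, Finset.mul_sum, ← Finset.sum_sub_distrib]
    refine Finset.sum_congr rfl fun i _ => ?_
    by_cases hy : X (i + 1) ω ∈ B
    · simp only [Set.indicator_of_mem hy]; ring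
    · simp only [Set.indicator_of_notMem hy]; ring
  rw [Set.mem_ofPred_eq, hsum]
  have := mul_lt_mul_of_pos_left (hω.trans_le hshift) hl
  linarith

end Indicator

/-! ### Exponential tightness -/

section Tightness

variable {E : Type*} [MetricSpace E] [MeasurableSpace E] [BorelSpace E] {P : Kernel E E}

/-- All kernels are dominated by `M • η`, and the single measure η is tight along a compact
exhaustion. -/
lemma DensityCondition.exists_isCompact_compl_le [SigmaCompactSpace E] (h : DensityCondition P)
    {ε : ℝ≥0∞} (hε : 0 < ε) : ∃ K : Set E, IsCompact K ∧ ∀ x, P x Kᶜ ≤ ε := by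
  obtain ⟨η, p, -, hdens, -, M, hM, hp⟩ := h
  have hlim : Tendsto (fun n => (η : Measure E) (compactCovering E n)ᶜ) atTop (𝓝 0) := by
    have h1 := tendsto_measure_iInter_atTop (μ := (η : Measure E))
      (s := fun n => (compactCovering E n)ᶜ)
      (fun n => (isCompact_compactCovering E n).measurableSet.compl.nullMeasurableSet)
      (fun i j hij => Set.compl_subset_compl.2 (compactCovering_subset E hij))
      ⟨0, measure_ne_top _ _⟩
    rwa [← Set.compl_iUnion, iUnion_compactCovering, Set.compl_univ, measure_empty] at h1
  have hlim2 := ENNReal.Tendsto.const_mul (a := ENNReal.ofReal M) hlim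
    (Or.inr ENNReal.ofReal_ne_top)
  rw [mul_zero] at hlim2
  obtain ⟨n, hn⟩ := (hlim2.eventually_lt_const hε).exists
  refine ⟨compactCovering E n, isCompact_compactCovering E n, fun x => ?_⟩
  rw [hdens x _ (isCompact_compactCovering E n).measurableSet.compl]
  calc _ ≤ ∫⁻ _ in (compactCovering E n)ᶜ, ENNReal.ofReal M ∂(η : Measure E) :=
        lintegral_mono fun y => ENNReal.ofReal_le_ofReal (hp x y).2
    _ ≤ ε := by rw [setLIntegral_const]; exact hn.le

variable [IsMarkovKernel P] {φ : ℕ → ℝ} {Ω : Type*} [mΩ : MeasurableSpace Ω] {ℱ : Filtration ℕ mΩ}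
  {X : ℕ → Ω → E}

/-- Measures giving mass at most `1 / (j + 1)` to the complement of `K j`. -/
def tightSet (K : ℕ → Set E) : Set (ProbabilityMeasure E) :=
  {ν | ∀ j, (ν : Measure E) (K j)ᶜ ≤ ENNReal.ofReal (1 / (j + 1 : ℝ))}

lemma isCompact_tightSet {K : ℕ → Set E} (hK : ∀ j, IsCompact (K j)) :
    IsCompact (tightSet K) := by
  have hu : Tendsto (fun j : ℕ => Real.toNNReal (1 / (j + 1 : ℝ))) atTop (𝓝 0) := by
    rw [← Real.toNNReal_zero]
    exact (continuous_real_toNNReal.tendsto 0).comp tendsto_one_div_add_atTop_nhds_zero_nat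
  have h := isCompact_setOfPred_probabilityMeasure_mass_eq_compl_isCompact_le hu hK
    (Or.inl inferInstance)
  convert! h using 1
  ext ν
  simp only [tightSet, Set.mem_ofPred_eq]
  refine forall_congr' fun j => ?_
  rw [ENNReal.ofReal, ← ProbabilityMeasure.ennreal_coeFn_eq_coeFn_toMeasure, ENNReal.coe_le_coe]

/-- Exponential tightness of the empirical measures with modified starting point. -/
lemma exists_isCompact_measure_notMem_tightSet_le (hφ : IsDiscountFactor φ)
    (hP : ∀ ε : ℝ≥0∞, 0 < ε → ∃ K : Set E, IsCompact K ∧ ∀ x, P x Kᶜ ≤ ε) (x₀ : E) {L : ℝ}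
    (hL : 0 ≤ L) :
    ∃ K : ℕ → Set E, (∀ j, IsCompact (K j)) ∧
      ∀ (μ : Measure Ω) (x : E) (k n : ℕ), IsMarkovChainFrom P ℱ X μ x → 0 < n →
        1 ≤ totalWeight φ k n →
        μ {ω | ¬ ∃ ν ∈ tightSet K, (ν : Measure E)
            = pathEmpirical φ k n (Function.update (fun i => X i ω) 0 x₀)}
          ≤ ENNReal.ofReal (Real.exp (-L * totalWeight φ k n)) := by
  -- Chosen so that l j / (j + 1) - 1 = L + (j + 1): for W ≥ 1 the j-th bound is at most e^{-LW}
  -- 2^{-(j+1)}, which sums to e^{-LW}.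
  set l : ℕ → ℝ := fun j => (j + 1) * (L + j + 2) with hl
  have hl0 (j : ℕ) : 0 ≤ l j := by positivity
  choose K₀ hK₀ hPK₀ using fun j =>
    hP (ENNReal.ofReal (Real.exp (-l j))) (ENNReal.ofReal_pos.2 (Real.exp_pos _))
  -- Inserting x₀ keeps the moved initial atom out of every complement.
  refine ⟨fun j => insert x₀ (K₀ j), fun j => (hK₀ j).insert x₀, fun μ x k n hμ hn hW => ?_⟩
  have hsub : {ω | ¬ ∃ ν ∈ tightSet fun j => insert x₀ (K₀ j), (ν : Measure E)
        = pathEmpirical φ k n (Function.update (fun i => X i ω) 0 x₀)}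
      ⊆ ⋃ j : ℕ, {ω | ENNReal.ofReal (1 / (j + 1 : ℝ))
        < pathEmpirical φ k n (Function.update (fun i => X i ω) 0 x₀) (insert x₀ (K₀ j))ᶜ} := by
    intro ω hω
    by_contra hcon
    simp only [Set.mem_iUnion, Set.mem_ofPred_eq, not_exists, not_lt] at hcon
    exact hω ⟨⟨_, hφ.isProbabilityMeasure_pathEmpirical k hn _⟩, hcon, rfl⟩
  set W := totalWeight φ k n with hWdef
  refine (measure_mono hsub).trans ((measure_iUnion_le _).trans ?_)
  calc _ ≤ ∑' j : ℕ, ENNReal.ofReal (Real.exp (-L * W)) * (2⁻¹ : ℝ≥0∞) ^ (j + 1) := by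
        refine ENNReal.tsum_le_tsum fun j => ?_
        have h1 := hμ.measure_pathEmpirical_update_gt_le hφ
          ((hK₀ j).insert x₀).measurableSet.compl (hl0 j)
          (fun z => (measure_mono (Set.compl_subset_compl.2 (Set.subset_insert _ _))).trans
            (hPK₀ j z)) (x₀ := x₀) (by simp) k hn (t := 1 / (j + 1 : ℝ)) (by positivity)
        refine h1.trans ?_
        have h2 : l j * (1 / (j + 1 : ℝ)) = L + j + 2 := by
          simp only [hl]
          field_simp
        have h3 : Real.exp (-1) ≤ 2⁻¹ := by
          rw [Real.exp_neg]
          exact inv_anti₀ two_pos (by linarith [Real.add_one_le_exp 1])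
        have h4 : Real.exp (-(L + j + 2 - 1) * W) ≤ Real.exp (-L * W) * 2⁻¹ ^ (j + 1) := by
          calc Real.exp (-(L + j + 2 - 1) * W)
              ≤ Real.exp (-L * W + ((j + 1 : ℕ) : ℝ) * (-1)) := by
                refine Real.exp_le_exp.2 ?_
                push_cast
                nlinarith [mul_nonneg (by positivity : (0 : ℝ) ≤ j + 1) (sub_nonneg.2 hW)]
            _ = Real.exp (-L * W) * Real.exp (-1) ^ (j + 1) := by
                rw [Real.exp_add, Real.exp_nat_mul]
            _ ≤ _ := by gcongr
        rw [h2]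
        refine (ENNReal.ofReal_le_ofReal h4).trans_eq ?_
        rw [ENNReal.ofReal_mul (Real.exp_pos _).le, ENNReal.ofReal_pow (by norm_num),
          ENNReal.ofReal_inv_of_pos two_pos, ENNReal.ofReal_ofNat]
    _ = ENNReal.ofReal (Real.exp (-L * W)) := by
        rw [ENNReal.tsum_mul_left, ENNReal.tsum_geometric_add_one, ENNReal.one_sub_inv_two, inv_inv,
          ENNReal.inv_mul_cancel two_ne_zero ENNReal.ofNat_ne_top, mul_one]

end Tightness

/-! ### Effect of moving the starting point -/

section Comparison

variable {E : Type*} [MetricSpace E] [MeasurableSpace E] [BorelSpace E] {φ : ℕ → ℝ}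

lemma IsDiscountFactor.abs_integral_pathEmpirical_update_sub_le (hφ : IsDiscountFactor φ) (k : ℕ)
    {n : ℕ} (hn : 0 < n) (y : ℕ → E) (x₀ : E) (g : E →ᵇ ℝ) :
    |∫ z, g z ∂(pathEmpirical φ k n y) - ∫ z, g z ∂(pathEmpirical φ k n (Function.update y 0 x₀))|
      ≤ (totalWeight φ k n)⁻¹ * (φ k * (2 * ‖g‖)) := by
  have hW := hφ.totalWeight_pos k hn
  rw [hφ.integral_pathEmpirical, hφ.integral_pathEmpirical, ← mul_sub, abs_mul,
    abs_of_pos (inv_pos.2 hW)]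
  refine mul_le_mul_of_nonneg_left ?_ (inv_pos.2 hW).le
  obtain ⟨m, rfl⟩ := Nat.exists_eq_succ_of_ne_zero hn.ne'
  rw [Finset.sum_range_succ', Finset.sum_range_succ' _ m]
  simp only [Function.update_of_ne (Nat.succ_ne_zero _), Function.update_self, add_zero]
  rw [add_sub_add_left_eq_sub, ← mul_sub, abs_mul, abs_of_pos (hφ.pos k)]
  refine mul_le_mul_of_nonneg_left ?_ (hφ.pos k).le
  have h1 := abs_le.1 (g.norm_coe_le_norm (y 0))
  have h2 := abs_le.1 (g.norm_coe_le_norm x₀)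
  exact abs_le.2 ⟨by linarith, by linarith⟩

/-- For large `n`, an empirical measure in the closed set `C` whose modification at time `0` lies in
the compact set `A` belongs to any given open neighbourhood of `C ∩ A`. -/
lemma IsDiscountFactor.eventually_mem_of_update_mem (hφ : IsDiscountFactor φ) (k : ℕ) (x₀ : E)
    {C A U : Set (ProbabilityMeasure E)} (hC : IsClosed C) (hA : IsCompact A) (hU : IsOpen U)
    (hCAU : C ∩ A ⊆ U) :
    ∀ᶠ n in atTop, ∀ (y : ℕ → E), ∀ ν ∈ C, ∀ ν' ∈ A, (ν : Measure E) = pathEmpirical φ k n y →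
      (ν' : Measure E) = pathEmpirical φ k n (Function.update y 0 x₀) → ν ∈ U := by
  by_contra hcon
  rw [not_eventually] at hcon
  obtain ⟨s, hs, hsP⟩ := extraction_of_frequently_atTop
    (hcon.and_eventually (eventually_gt_atTop 0))
  have hs_pos (m : ℕ) : 0 < s m := (hsP m).2
  have hex (m : ℕ) := (hsP m).1
  push Not at hex
  choose y ν hνC ν' hν'A hν hν' hνU using hex
  -- A limit along this ultrafilter replaces a convergent subsequence of the counterexamples: ν'
  -- converges in A, and ν has the same limit because their integrals differ by O(1/W).
  let u : Ultrafilter ℕ := Ultrafilter.of atTop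
  have hu : (u : Filter ℕ) ≤ atTop := Ultrafilter.of_le atTop
  obtain ⟨ν₀, hν₀A, hν₀⟩ := hA.ultrafilter_le_nhds (u.map ν')
    (le_principal_iff.2 (Eventually.of_forall hν'A : ∀ᶠ m in (u : Filter ℕ), ν' m ∈ A))
  have hlim' : Tendsto ν' u (𝓝 ν₀) := hν₀
  have hlim : Tendsto ν u (𝓝 ν₀) := by
    rw [ProbabilityMeasure.tendsto_iff_forall_integral_tendsto] at hlim' ⊢
    intro g
    have hdiff : Tendsto (fun m => ∫ z, g z ∂(ν m : Measure E) - ∫ z, g z ∂(ν' m : Measure E))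
        atTop (𝓝 0) := by
      refine squeeze_zero_norm (a := fun m => (totalWeight φ k (s m))⁻¹ * (φ k * (2 * ‖g‖)))
        (fun m => ?_) ?_
      · rw [hν, hν']
        exact hφ.abs_integral_pathEmpirical_update_sub_le k (hs_pos m) _ _ g
      · have h := ((tendsto_inv_atTop_zero.comp (hφ.tendsto_totalWeight k)).comp
          hs.tendsto_atTop).mul_const (φ k * (2 * ‖g‖))
        rwa [zero_mul] at h
    have h := (hdiff.mono_left hu).add (hlim' g)
    simpa using h
  have hmem : ν₀ ∈ C ∩ Uᶜ := (hC.inter hU.isClosed_compl).mem_of_tendsto hlim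
    (Eventually.of_forall fun m => ⟨hνC m, hνU m⟩)
  exact hmem.2 (hCAU ⟨hmem.1, hν₀A⟩)

end Comparison

lemma empiricalLaw_mono {E Ω : Type*} [MeasurableSpace E] [MeasurableSpace Ω] {φ : ℕ → ℝ}
    {X : ℕ → Ω → E} (μ : Measure Ω) (k n : ℕ) {C D : Set (ProbabilityMeasure E)}
    (h : C ⊆ D) : empiricalLaw φ X μ k n C ≤ empiricalLaw φ X μ k n D :=
  measure_mono fun _ ⟨ν, hν, hνω⟩ => ⟨ν, h hν, hνω⟩

/-! ### Upper bounds for compact and closed sets -/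

section UpperBound

variable {E : Type*} [MetricSpace E] [MeasurableSpace E] [BorelSpace E] {P : Kernel E E}
  [IsMarkovKernel P] {φ : ℕ → ℝ} {Ω : Type*} [mΩ : MeasurableSpace Ω] {ℱ : Filtration ℕ mΩ}
  {X : ℕ → Ω → E}

lemma exists_empiricalLaw_iUnion_rateHalfspace_le (hP : IsFeller P) (hφ : IsDiscountFactor φ)
    (F : Finset {f : E →ᵇ ℝ // IsTestFunction f}) (b : ℝ) (k : ℕ) :
    ∃ K : ℝ, 0 ≤ K ∧ ∀ (μ : Measure Ω) (x : E), IsMarkovChainFrom P ℱ X μ x → ∀ n > 0,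
      empiricalLaw φ X μ k n (⋃ f ∈ F, rateHalfspace P b f)
        ≤ ENNReal.ofReal (K * Real.exp (-b * totalWeight φ k n)) := by
  choose c hc using fun f : {f : E →ᵇ ℝ // IsTestFunction f} =>
    f.2.exists_empiricalLaw_rateHalfspace_le (ℱ := ℱ) (X := X) hP hφ b k
  refine ⟨∑ f ∈ F, Real.exp (c f), Finset.sum_nonneg fun f _ => (Real.exp_pos _).le,
    fun μ x hμ n hn => ?_⟩
  calc _ ≤ μ (⋃ f ∈ F, {ω | ∃ ν ∈ rateHalfspace P b f,
        (ν : Measure E) = weightedEmpirical φ X k n ω}) := by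
        refine measure_mono ?_
        rintro ω ⟨ν, hν, hνω⟩
        simp only [Set.mem_iUnion] at hν ⊢
        obtain ⟨f, hf, hfν⟩ := hν
        exact ⟨f, hf, ν, hfν, hνω⟩
    _ ≤ ∑ f ∈ F, ENNReal.ofReal (Real.exp (c f - b * totalWeight φ k n)) :=
        (measure_biUnion_finset_le _ _).trans
          (Finset.sum_le_sum fun f _ => hc f μ x hμ n hn)
    _ = _ := by
        rw [← ENNReal.ofReal_sum_of_nonneg fun f _ => (Real.exp_pos _).le, Finset.sum_mul]
        congr 1
        refine Finset.sum_congr rfl fun f _ => ?_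
        rw [← Real.exp_add]
        ring_nf

lemma exists_empiricalLaw_le_of_isCompact (hP : IsFeller P) (hφ : IsDiscountFactor φ)
    {C : Set (ProbabilityMeasure E)} (hC : IsCompact C) {b : ℝ}
    (hb : ∀ ν ∈ C, (b : EReal) < rate P ν) (k : ℕ) :
    ∃ K : ℝ, 0 ≤ K ∧ ∀ᶠ n in atTop, ∀ (μ : Measure Ω) (x : E), IsMarkovChainFrom P ℱ X μ x →
      empiricalLaw φ X μ k n C ≤ ENNReal.ofReal (K * Real.exp (-b * totalWeight φ k n)) := by
  obtain ⟨F, hF⟩ := exists_finset_rateHalfspace hP hC hb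
  obtain ⟨K, hK, h⟩ := exists_empiricalLaw_iUnion_rateHalfspace_le (ℱ := ℱ) (X := X) hP hφ F b k
  refine ⟨K, hK, ?_⟩
  filter_upwards [eventually_gt_atTop 0] with n hn μ x hμ
  exact (empiricalLaw_mono μ k n hF).trans (h μ x hμ n hn)

/-- Either the modified empirical measure leaves the compact tight set A, which is exponentially
unlikely, or for large n the true one lies in the finite union of half-spaces covering C ∩ A. -/
lemma exists_empiricalLaw_le_of_isClosed (hP : IsFeller P) (hφ : IsDiscountFactor φ)
    (htight : ∀ ε : ℝ≥0∞, 0 < ε → ∃ K : Set E, IsCompact K ∧ ∀ x, P x Kᶜ ≤ ε) (x₀ : E)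
    {C : Set (ProbabilityMeasure E)} (hC : IsClosed C) {b : ℝ}
    (hb : ∀ ν ∈ C, (b : EReal) < rate P ν) (k : ℕ) :
    ∃ K : ℝ, 0 ≤ K ∧ ∀ᶠ n in atTop, ∀ (μ : Measure Ω) (x : E), IsMarkovChainFrom P ℱ X μ x →
      empiricalLaw φ X μ k n C ≤ ENNReal.ofReal (K * Real.exp (-b * totalWeight φ k n)) := by
  -- The rate |b| is nonnegative, as tightness requires, and at least b.
  obtain ⟨K, hK, hKbound⟩ := exists_isCompact_measure_notMem_tightSet_le (ℱ := ℱ) (X := X) hφ htight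
    x₀ (abs_nonneg b)
  have hA := isCompact_tightSet hK
  obtain ⟨F, hF⟩ := exists_finset_rateHalfspace hP (hA.inter_left hC) fun ν hν => hb ν hν.1
  obtain ⟨c, hc, hcF⟩ := exists_empiricalLaw_iUnion_rateHalfspace_le (ℱ := ℱ) (X := X) hP hφ F b k
  have hU : IsOpen (⋃ f ∈ F, rateHalfspace P b f) :=
    isOpen_biUnion fun f _ => f.2.isOpen_rateHalfspace hP b
  refine ⟨c + 1, by positivity, ?_⟩
  filter_upwards [eventually_gt_atTop 0, (hφ.tendsto_totalWeight k).eventually_ge_atTop 1,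
    hφ.eventually_mem_of_update_mem k x₀ hC hA hU hF] with n hn hW hev μ x hμ
  have hexp : Real.exp (-|b| * totalWeight φ k n) ≤ Real.exp (-b * totalWeight φ k n) :=
    Real.exp_le_exp.2 (mul_le_mul_of_nonneg_right (neg_le_neg (le_abs_self b)) (by linarith))
  calc empiricalLaw φ X μ k n C
      ≤ empiricalLaw φ X μ k n (⋃ f ∈ F, rateHalfspace P b f)
        + μ {ω | ¬ ∃ ν ∈ tightSet K, (ν : Measure E)
            = pathEmpirical φ k n (Function.update (fun i => X i ω) 0 x₀)} := by
        refine (measure_mono ?_).trans (measure_union_le _ _)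
        rintro ω ⟨ν, hν, hνω⟩
        by_cases h : ∃ ν ∈ tightSet K, (ν : Measure E)
            = pathEmpirical φ k n (Function.update (fun i => X i ω) 0 x₀)
        · obtain ⟨ν', hν', hνω'⟩ := h
          exact Or.inl ⟨ν, hev (fun i => X i ω) ν hν ν' hν'
            (hνω.trans (weightedEmpirical_eq_pathEmpirical φ X k n ω)) hνω', hνω⟩
        · exact Or.inr h
    _ ≤ ENNReal.ofReal (c * Real.exp (-b * totalWeight φ k n))
        + ENNReal.ofReal (Real.exp (-b * totalWeight φ k n)) :=
        add_le_add (hcF μ x hμ n hn)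
          ((hKbound μ x k n hμ hn hW).trans (ENNReal.ofReal_le_ofReal hexp))
    _ = _ := by
        rw [← ENNReal.ofReal_add (by positivity) (by positivity)]
        ring_nf

end UpperBound

/-! ### Passage to the logarithmic limit -/

lemma limsup_inv_mul_iSup_log_le {ι : Type*} {W : ℕ → ℝ} (hW : Tendsto W atTop atTop)
    {q : ℕ → ι → ℝ≥0∞} {K b : ℝ}
    (h : ∀ᶠ n in atTop, ∀ x, q n x ≤ ENNReal.ofReal (K * Real.exp (-b * W n))) (hK : 0 ≤ K) :
    limsup (fun n => (((W n)⁻¹ : ℝ) : EReal) * ⨆ x, ENNReal.log (q n x)) atTop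
      ≤ ((-b : ℝ) : EReal) := by
  have hlim : Tendsto (fun n => (W n)⁻¹ * Real.log (K + 1) - b) atTop (𝓝 (-b)) := by
    have h1 := ((tendsto_inv_atTop_zero.comp hW).mul_const (Real.log (K + 1))).sub_const b
    simpa using h1
  have hlim' := (continuous_coe_real_ereal.tendsto (-b)).comp hlim
  rw [← hlim'.limsup_eq]
  refine limsup_le_limsup ?_
  filter_upwards [h, hW.eventually_gt_atTop 0] with n hn hWn
  -- Using K + 1 keeps the logarithm of the constant finite when K = 0.
  have hsup : ⨆ x, ENNReal.log (q n x) ≤ ((Real.log (K + 1) - b * W n : ℝ) : EReal) := by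
    refine iSup_le fun x => ?_
    have hpos : 0 < (K + 1) * Real.exp (-b * W n) := by positivity
    calc ENNReal.log (q n x) ≤ ENNReal.log (ENNReal.ofReal ((K + 1) * Real.exp (-b * W n))) := by
          refine ENNReal.log_le_log ((hn x).trans (ENNReal.ofReal_le_ofReal ?_))
          gcongr
          linarith
      _ = _ := by
          rw [ENNReal.log_ofReal_of_pos hpos, Real.log_mul (by positivity) (Real.exp_pos _).ne',
            Real.log_exp]
          ring_nf
  have hinv : (0 : EReal) ≤ (((W n)⁻¹ : ℝ) : EReal) := EReal.coe_nonneg.2 (inv_pos.2 hWn).le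
  refine (mul_le_mul_of_nonneg_left hsup hinv).trans_eq ?_
  rw [← EReal.coe_mul, Function.comp_apply]
  congr 1
  field_simp

end DiscountedLDP

theorem mainTheorem5 {E : Type*} [MetricSpace E] [TopologicalSpace.SeparableSpace E]
    [LocallyCompactSpace E] [MeasurableSpace E] [BorelSpace E]
    (P : Kernel E E) [IsMarkovKernel P] (hP : DiscountedLDP.IsFeller P)
    (φ : ℕ → ℝ) (hφ : DiscountedLDP.IsDiscountFactor φ)
    {Ω : Type*} [mΩ : MeasurableSpace Ω] (ℱ : Filtration ℕ mΩ)
    (X : ℕ → Ω → E) (Pr : ℕ → E → Measure Ω)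
    (hX : ∀ k x, DiscountedLDP.IsMarkovChainFrom P ℱ X (Pr k x) x)
    (C : Set (ProbabilityMeasure E))
    (hC : IsCompact C ∨ (IsClosed C ∧ DiscountedLDP.DensityCondition P)) (k : ℕ) :
    limsup (fun n : ℕ => (((DiscountedLDP.totalWeight φ k n)⁻¹ : ℝ) : EReal) *
        ⨆ x : E, ENNReal.log (DiscountedLDP.empiricalLaw φ X (Pr k x) k n C)) atTop
      ≤ - ⨅ ν ∈ C, DiscountedLDP.rate P ν := by
  -- It suffices to bound by every real z > -inf I; then b = -z is strictly below I on C, even where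
  -- I is infinite.
  rw [← EReal.le_of_forall_lt_iff_le]
  intro z hz
  have hb (ν : ProbabilityMeasure E) (hν : ν ∈ C) :
      ((-z : ℝ) : EReal) < DiscountedLDP.rate P ν := by
    rw [EReal.coe_neg]
    exact (EReal.neg_lt_comm.1 hz).trans_le (iInf₂_le ν hν)
  suffices h : ∃ K : ℝ, 0 ≤ K ∧ ∀ᶠ n in atTop, ∀ x, DiscountedLDP.empiricalLaw φ X (Pr k x) k n C
      ≤ ENNReal.ofReal (K * Real.exp (-(-z) * DiscountedLDP.totalWeight φ k n)) by
    obtain ⟨K, hK, h⟩ := h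
    simpa using DiscountedLDP.limsup_inv_mul_iSup_log_le (hφ.tendsto_totalWeight k) h hK
  rcases isEmpty_or_nonempty E with hE | ⟨⟨x₀⟩⟩
  -- An empty E offers no reference point x₀, but then there is no starting point to bound.
  · exact ⟨0, le_rfl, Eventually.of_forall fun n x => hE.elim x⟩
  have hbound : ∃ K : ℝ, 0 ≤ K ∧ ∀ᶠ n in atTop, ∀ (μ : Measure Ω) (x : E),
      DiscountedLDP.IsMarkovChainFrom P ℱ X μ x → DiscountedLDP.empiricalLaw φ X μ k n C
        ≤ ENNReal.ofReal (K * Real.exp (-(-z) * DiscountedLDP.totalWeight φ k n)) := by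
    rcases hC with hC | ⟨hC, hD⟩
    · exact DiscountedLDP.exists_empiricalLaw_le_of_isCompact hP hφ hC hb k
    · have : SecondCountableTopology E := UniformSpace.secondCountable_of_separable E
      exact DiscountedLDP.exists_empiricalLaw_le_of_isClosed hP hφ
        (fun ε hε => hD.exists_isCompact_compl_le hε) x₀ hC hb k
  obtain ⟨K, hK, h⟩ := hbound
  exact ⟨K, hK, h.mono fun n hn x => hn _ x (hX k x)⟩
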